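/- Define polynomials $P_{-4,n}(c)\in\mathbb C[c]$, $n\ge 0$, by $P_{-4,0}=1$, $P_{-4,1}=P_{-4,2}=P_{-4,3}=0$ and $$(6+2k)P_{-4,k+4}(c)=4kc\,P_{-4,k+2}(c)-2(k-3)P_{-4,k}(c)\qquad(k\ge 0),$$ and put $q_n=P_{-4,2n+4}$ for $n\ge 0$. For constants $\nu,\gamma$ ($\gamma$ not a negative integer) let $C_n^{(\nu)}(x;\gamma)$ be the associated ultraspherical polynomials, defined by $C_{-1}^{(\nu)}=0$, $C_0^{(\nu)}=1$ and $$2x(n+\nu+\gamma)C_n^{(\nu)}=(n+\gamma+1)C_{n+1}^{(\nu)}+(2\nu+n+\gamma-1)C_{n-1}^{(\nu)}\qquad (n\ge 0).$$ Then: 1. $P_{-4,n}=0$ for every odd $n$, and $q_n(x)=C_n^{(-1/2)}(x;3/2)$ for all $n\ge 0$. 2. The sequence $(q_n)_{n\ge 0}$ is a sequence of orthogonal polynomials: $\deg q_n=n$, and $\int_{-1}^{1}q_m(x)\overline{q_n(x)}\,\rho(x)\,dx=0$ for $m\ne n$, where with $\beta=-1/2$, $\gamma=3/2$, $$\rho(\cos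 t)=\frac{(2\sin t)^{2\beta-1}\,\Gamma(\beta+\gamma)^2}{2\pi\,\Gamma(2\beta+\gamma)\,\Gamma(\gamma+1)}\,\bigl|{}_2F_1(1-\beta,\gamma;\gamma+\beta;e^{2it})\bigr|^{-2}\qquad(0<t<\pi),$$ $\rho=0$ off $(-1,1)$. Here ${}_2F_1(a,b;c;z)=\sum_{n\ge0}\frac{(a)_n(b)_n}{(c)_n\,n!}z^n$ for $|z|<1$, and its value at $e^{2it}$ is the radial limit $\lim_{r\to1^-}{}_2F_1(a,b;c;re^{2it})$. The function $\rho$ is a weight function in the following sense: a weight function is a function $w:\mathbb R\to[0,\infty)$ that has finite moments of all orders and is not almost everywhere zero. 3. The $q_n$ are not classical: for every weight function $w$ for which $(q_n)$ is orthogonal there is no second-order differential operator $D=f_2(x)\frac{d^2}{dx^2}+f_1(x)\frac{d}{dx}+f_0(x)$ on the real line, with functions $f_i:\mathbb R\to\mathbb C$ and $f_2\not\equiv 0$, that is symmetric, i.e. $\int (Dg)\,\overline{h}\,w\,dx=\int g\,\overline{Dh}\,w\,dx$ for all $g,h\in\mathbb C[x]$, and satisfies $Dq_n=\gamma_nq_n$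 with $\gamma_n\in\mathbb C$ for all $n\ge 0$. -/

import Mathlib

open Polynomial Set Filter Topology MeasureTheory

namespace DJKM

/-- The polynomials `P_{-4,n}` (variable `c`, written `X`), indexed so that the generating function
is `∑_{n ≥ 0} P_{-4,n}(c) z ^ n`: the solution of
`(6 + 2k) P_{k+4} = 4 k c P_{k+2} - 2 (k - 3) P_k` (`k ≥ 0`) with
`P_0 = 1`, `P_1 = P_2 = P_3 = 0`. -/
noncomputable def P : ℕ → ℂ[X]
  | 0 => 1
  | 1 => 0
  | 2 => 0
  | 3 => 0
  | k + 4 => C (1 / (6 + 2 * (k : ℂ))) *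
      (C (4 * (k : ℂ)) * X * P (k + 2) - C (2 * ((k : ℂ) - 3)) * P k)

/-- The polynomials `q_n = P_{-4,2n+4}`, `n ≥ 0`. -/
noncomputable def q (n : ℕ) : ℂ[X] := P (2 * n + 4)

/-- The associated ultraspherical polynomials `C_n^{(ν)}(x; c)`: the solution of
`2 x (n + ν + c) C_n = (n + c + 1) C_{n+1} + (2ν + n + c - 1) C_{n-1}` (`n ≥ 0`) with
`C_{-1} = 0`, `C_0 = 1` (for `c` not a negative integer). -/
noncomputable def assocUltraspherical (ν c : ℂ) : ℕ → ℂ[X]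
  | 0 => 1
  | 1 => C (2 * (ν + c) / (c + 1)) * X
  | n + 2 => C (1 / ((n : ℂ) + 1 + c + 1)) *
      (C (2 * ((n : ℂ) + 1 + ν + c)) * X * assocUltraspherical ν c (n + 1)
        - C (2 * ν + ((n : ℂ) + 1) + c - 1) * assocUltraspherical ν c n)

/-- The boundary value at a point `z` of the unit circle of the Gauss hypergeometric function
`₂F₁(a, b; c; ·)` on the open unit disc, as a radial limit. (On the circle itself the
hypergeometric series may diverge.) -/
noncomputable def hypBoundary (a b c z : ℂ) : ℂ :=
  limUnder (𝓝[<] (1 : ℝ)) (fun r : ℝ => ₂F₁ a b c ((r : ℂ) * z))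

open Classical in
/-- The weight of the associated ultraspherical polynomials `C_n^{(β)}(x; γ)`: it vanishes
off `(-1, 1)`, and at `x = cos t`, `0 < t < π`, it is
`(2 sin t)^(2β-1) Γ(β+γ)² / (2π Γ(2β+γ) Γ(γ+1)) * |₂F₁(1-β, γ; γ+β; exp(2it))|⁻²`. -/
noncomputable def ultrasphericalWeight (β γ : ℝ) (x : ℝ) : ℝ :=
  if x ∈ Ioo (-1 : ℝ) 1 then
    (2 * Real.sin (Real.arccos x)) ^ (2 * β - 1) * Real.Gamma (β + γ) ^ 2 /
        (2 * Real.pi * Real.Gamma (2 * β + γ) * Real.Gamma (γ + 1)) *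
      (‖hypBoundary (1 - (β : ℂ)) (γ : ℂ) ((γ : ℂ) + (β : ℂ))
          (Complex.exp (2 * Complex.I * (Real.arccos x : ℂ)))‖ ^ 2)⁻¹
  else 0

/-- `w` is a weight function on the real line: nonnegative, with finite moments of all orders,
and not almost everywhere zero. -/
structure IsWeight (w : ℝ → ℝ) : Prop where
  nonneg : ∀ x, 0 ≤ w x
  integrable : ∀ n : ℕ, Integrable (fun x : ℝ => x ^ n * w x)
  nontrivial : 0 < volume (Function.support w)

/-- The inner product `(f, g) = ∫ f(x) conj(g(x)) w(x) dx`. -/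
noncomputable def wInner (w : ℝ → ℝ) (f g : ℝ → ℂ) : ℂ :=
  ∫ x : ℝ, f x * (starRingEnd ℂ) (g x) * (w x : ℂ)

/-- The function on the real line defined by a polynomial. -/
noncomputable def toFun (p : ℂ[X]) (x : ℝ) : ℂ := p.eval (x : ℂ)

/-- `p` is a sequence of orthogonal polynomials for the weight `w`: `p n` has degree exactly `n`
and distinct members are orthogonal. -/
structure IsOrthogonal (w : ℝ → ℝ) (p : ℕ → ℂ[X]) : Prop where
  degree : ∀ n, (p n).degree = n
  orthogonal : ∀ m n, m ≠ n → wInner w (toFun (p m)) (toFun (p n)) = 0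

/-- The differential operator `∑_{i ≤ s} f_i(x) (d/dx)^i` on the real line, with arbitrary
complex valued coefficient functions, applied to a polynomial. -/
noncomputable def diffOp (s : ℕ) (f : ℕ → ℝ → ℂ) (p : ℂ[X]) (x : ℝ) : ℂ :=
  ∑ i ∈ Finset.range (s + 1), f i x * toFun (derivative^[i] p) x

/-- The weight `w`, with its sequence `p` of orthogonal polynomials, is classical: some symmetric
differential operator of order two has every `p n` as an eigenfunction. -/
def IsClassical (w : ℝ → ℝ) (p : ℕ → ℂ[X]) : Prop :=
  ∃ f : ℕ → ℝ → ℂ, f 2 ≠ 0 ∧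
    (∀ g h : ℂ[X], wInner w (diffOp 2 f g) (toFun h) = wInner w (toFun g) (diffOp 2 f h)) ∧
    ∃ γ : ℕ → ℂ, ∀ n x, diffOp 2 f (p n) x = γ n * toFun (p n) x

end DJKM

namespace DJKM

/-! Write `F_n` for `assocFun n`, `x = cos t`, `z = exp(it)`, `h_n` for `halfCoeff n`. A contiguous
relation makes `M_n = h_n z^n F_n(z²)` a solution of the recurrence of the `q_n` with index shifted
by one (`minimalSol_succ_succ`). Since the recurrence is real, `Im (M_{n+1} conj M_0)` solves it
too; it vanishes at the index before `q_0`, so it is `q_n(x)` times its initial value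
(`im_minimalSol_mul_conj_zero`). That value is a Casoratian, and letting `n → ∞` shows that it is a
constant times `sin² t` (`exists_casoratian_zero`).

By Euler's transformation the weight is a constant times `sin² t / |F_0(z²)|²`. Hence `q_n ρ` is a
constant times `Im (z^{n+1} F_{n+1}(z²) / F_0(z²))` (`exists_eval_q_mul_weight`). As `F_0` has no
zero in the closed disc, integrating against `x^m` with `m < n` gives a contour integral of a
function holomorphic in the disc, which vanishes by Cauchy (`integral_cos_pow_mul_sin_mul_im`).

Non-classicality is linear algebra: the eigenvalue equations for `q_0, q_1, q_2` determine the
operator up to its eigenvalues, and those for `q_3, q_4` then force `f_2 = 0`. -/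

/-! ### The recurrence of the `q n`. -/

lemma P_succ_four (k : ℕ) : P (k + 4) = C (1 / (6 + 2 * (k : ℂ))) *
    (C (4 * (k : ℂ)) * X * P (k + 2) - C (2 * ((k : ℂ) - 3)) * P k) := by
  rw [P]

lemma P_odd (n : ℕ) : P (2 * n + 1) = 0 := by
  induction n using Nat.twoStepInduction with
  | zero => simp [P]
  | one => simp [P]
  | more n h1 h2 =>
    rw [show 2 * (n + 2) + 1 = 2 * n + 1 + 4 by ring, P_succ_four,
      show 2 * n + 1 + 2 = 2 * (n + 1) + 1 by ring, h1, h2]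
    simp

lemma q_zero : q 0 = 1 := by
  simp only [q, P]
  rw [← C_1, ← C_0]
  simp only [← C_mul, ← C_neg, C_0, mul_zero, zero_sub, mul_one]
  norm_num [← C_mul, ← C_neg]

lemma q_one : q 1 = C (4 / 5) * X := by
  rw [q, show 2 * 1 + 4 = 2 + 4 by rfl, P_succ_four, show 2 + 2 = 2 * 0 + 4 by rfl, ← q, q_zero,
    show P 2 = 0 by simp [P], mul_zero, sub_zero, mul_one, ← mul_assoc, ← C_mul]
  norm_num

lemma natCast_add_seven_halves_ne_zero (n : ℕ) : (n : ℂ) + 7 / 2 ≠ 0 := by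
  have h : ((2 * n + 7 : ℕ) : ℂ) ≠ 0 := Nat.cast_ne_zero.2 (by omega)
  intro h0
  apply h
  push_cast
  linear_combination 2 * h0

lemma q_succ_succ (n : ℕ) : q (n + 2) = C (1 / ((n : ℂ) + 7 / 2)) *
    (C (2 * ((n : ℂ) + 2)) * X * q (n + 1) - C ((n : ℂ) + 1 / 2) * q n) := by
  have h' := natCast_add_seven_halves_ne_zero n
  have h : (6 + 2 * ((2 * n + 4 : ℕ) : ℂ)) ≠ 0 := by
    rw [show 6 + 2 * ((2 * n + 4 : ℕ) : ℂ) = 4 * (n + 7 / 2) by push_cast; ring]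
    exact mul_ne_zero (by norm_num) h'
  have e1 : 1 / (6 + 2 * ((2 * n + 4 : ℕ) : ℂ)) * (4 * ((2 * n + 4 : ℕ) : ℂ)) =
      1 / ((n : ℂ) + 7 / 2) * (2 * ((n : ℂ) + 2)) := by
    rw [one_div_mul_eq_div, one_div_mul_eq_div, div_eq_div_iff h h']
    push_cast
    ring
  have e2 : 1 / (6 + 2 * ((2 * n + 4 : ℕ) : ℂ)) * (2 * (((2 * n + 4 : ℕ) : ℂ) - 3)) =
      1 / ((n : ℂ) + 7 / 2) * ((n : ℂ) + 1 / 2) := by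
    rw [one_div_mul_eq_div, one_div_mul_eq_div, div_eq_div_iff h h']
    push_cast
    ring
  rw [q, show 2 * (n + 2) + 4 = (2 * n + 4) + 4 by ring, P_succ_four,
    show 2 * n + 4 + 2 = 2 * (n + 1) + 4 by ring, ← q, ← q]
  have key : ∀ {a b c d e f : ℂ} (r s : ℂ[X]), a * b = d * e → a * c = d * f →
      C a * (C b * X * r - C c * s) = C d * (C e * X * r - C f * s) := by
    intro a b c d e f r s h1 h2
    have h1' := congrArg C h1
    have h2' := congrArg C h2
    rw [C_mul, C_mul] at h1' h2'
    linear_combination X * r * h1' - s * h2'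
  exact key _ _ e1 e2

lemma q_eq_assocUltraspherical (n : ℕ) : q n = assocUltraspherical (-1 / 2) (3 / 2) n := by
  induction n using Nat.twoStepInduction with
  | zero => rw [q_zero, assocUltraspherical]
  | one => rw [q_one, assocUltraspherical]; norm_num
  | more n h1 h2 =>
    rw [q_succ_succ, assocUltraspherical, h1, h2,
      show (n : ℂ) + 1 + 3 / 2 + 1 = n + 7 / 2 by ring,
      show (n : ℂ) + 1 + -1 / 2 + 3 / 2 = n + 2 by ring,
      show 2 * (-1 / 2) + ((n : ℂ) + 1) + 3 / 2 - 1 = n + 1 / 2 by ring]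

lemma eval_q_succ_succ (n : ℕ) (x : ℂ) : ((n : ℂ) + 7 / 2) * (q (n + 2)).eval x =
    2 * ((n : ℂ) + 2) * x * (q (n + 1)).eval x - ((n : ℂ) + 1 / 2) * (q n).eval x := by
  rw [q_succ_succ]
  simp only [eval_mul, eval_sub, eval_C, eval_X]
  rw [← mul_assoc, mul_one_div_cancel (natCast_add_seven_halves_ne_zero n), one_mul]

/-- The recurrence has real coefficients; this removes the conjugation from `wInner`. -/
lemma conj_eval_q (n : ℕ) (x : ℝ) : starRingEnd ℂ ((q n).eval (x : ℂ)) = (q n).eval (x : ℂ) := by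
  induction n using Nat.twoStepInduction with
  | zero => simp [q_zero]
  | one => simp [q_one, map_ofNat]
  | more n h1 h2 =>
    have h := congrArg (starRingEnd ℂ) (eval_q_succ_succ n x)
    simp only [map_mul, map_sub, map_add, map_div₀, map_ofNat, map_natCast, map_one,
      Complex.conj_ofReal, h1, h2] at h
    rw [← eval_q_succ_succ] at h
    exact mul_left_cancel₀ (natCast_add_seven_halves_ne_zero n) h

lemma degree_q (n : ℕ) : (q n).degree = n := by
  induction n using Nat.twoStepInduction with
  | zero => simp [q_zero]
  | one => rw [q_one, degree_C_mul_X (by norm_num)]; rfl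
  | more n h1 h2 =>
    have h3 : (n : ℂ) + 2 ≠ 0 := by
      have : ((n + 2 : ℕ) : ℂ) ≠ 0 := Nat.cast_ne_zero.2 (by omega)
      exact_mod_cast this
    have h4 : (C (2 * ((n : ℂ) + 2)) * X * q (n + 1)).degree = ((n + 2 : ℕ) : WithBot ℕ) := by
      rw [degree_mul, degree_C_mul_X (mul_ne_zero two_ne_zero h3), h2]
      norm_cast
      ring
    have h5 : (C ((n : ℂ) + 1 / 2) * q n).degree <
        (C (2 * ((n : ℂ) + 2)) * X * q (n + 1)).degree := by
      rw [h4]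
      refine (degree_mul_le _ _).trans_lt ((add_le_add degree_C_le h1.le).trans_lt ?_)
      norm_cast
      omega
    rw [q_succ_succ, degree_C_mul (one_div_ne_zero (natCast_add_seven_halves_ne_zero n)),
      degree_sub_eq_left_of_degree_lt h5, h4]

/-! ### Second-order operators with all `q n` as eigenfunctions. -/

lemma q_two : q 2 = C (32 / 35) * X ^ 2 - C (1 / 7) := by
  refine Polynomial.funext fun x => mul_left_cancel₀ (natCast_add_seven_halves_ne_zero 0) ?_
  rw [eval_q_succ_succ 0, q_one, q_zero]
  simp
  ring

lemma q_three : q 3 = C (128 / 105) * X ^ 3 - C (16 / 35) * X := by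
  refine Polynomial.funext fun x => mul_left_cancel₀ (natCast_add_seven_halves_ne_zero 1) ?_
  rw [eval_q_succ_succ 1, q_two, q_one]
  simp
  ring

lemma q_four : q 4 = C (2048 / 1155) * X ^ 4 - C (416 / 385) * X ^ 2 + C (5 / 77) := by
  refine Polynomial.funext fun x => mul_left_cancel₀ (natCast_add_seven_halves_ne_zero 2) ?_
  rw [eval_q_succ_succ 2, q_three, q_two]
  simp
  ring

/-- No second-order differential operator has all `q n` as eigenfunctions; here symmetry
of the operator is not needed. -/
lemma eq_zero_of_forall_diffOp_q {f : ℕ → ℝ → ℂ} {γ : ℕ → ℂ}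
    (h : ∀ n x, diffOp 2 f (q n) x = γ n * toFun (q n) x) : f 2 = 0 := by
  have e0 : ∀ x, f 0 x = γ 0 := fun x => by
    simpa [diffOp, toFun, q_zero, Finset.sum_range_succ] using h 0 x
  have e1 : ∀ x, f 1 x = (γ 1 - γ 0) * x := fun x => by
    have := h 1 x
    simp [diffOp, toFun, q_one, Finset.sum_range_succ, e0] at this
    linear_combination 5 / 4 * this
  have e2 : ∀ x, f 2 x = ((γ 2 - γ 0) / 2 - (γ 1 - γ 0)) * x ^ 2 - 5 / 64 * (γ 2 - γ 0) :=
    fun x => by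
      have := h 2 x
      simp [diffOp, toFun, q_two, Finset.sum_range_succ, e0, e1] at this
      linear_combination 35 / 64 * this
  have e3 : ∀ x, _ := fun x => h 3 x
  have e4 : ∀ x, _ := fun x => h 4 x
  simp [diffOp, toFun, q_three, Finset.sum_range_succ, e0, e1, e2] at e3
  simp [diffOp, toFun, q_four, Finset.sum_range_succ, e0, e1, e2] at e4
  -- These sample points give linear equations in the eigenvalue differences, enough to force `γ 0 =
  -- γ 1 = γ 2`.
  have e31 := e3 1
  have e32 := e3 2
  have e40 := e4 0
  have e41 := e4 1
  have e42 := e4 2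
  norm_num at e31 e32 e40 e41 e42
  have hE : γ 1 - γ 0 = 0 := by grind
  have hG : γ 2 - γ 0 = 0 := by grind
  ext x
  simp [e2, hE, hG]

/-! ### Taylor coefficients of the square root. -/

/-- The Taylor coefficients of `(1 - w) ^ (1 / 2)`. -/
noncomputable def halfCoeff (k : ℕ) : ℝ :=
  ∏ j ∈ Finset.range k, (((j : ℝ) - 1 / 2) / ((j : ℝ) + 1))

@[simp] lemma halfCoeff_zero : halfCoeff 0 = 1 := by simp [halfCoeff]

lemma halfCoeff_succ (k : ℕ) :
    halfCoeff (k + 1) = halfCoeff k * (((k : ℝ) - 1 / 2) / ((k : ℝ) + 1)) := by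
  rw [halfCoeff, Finset.prod_range_succ, ← halfCoeff]

lemma natCast_sub_half_ne_zero (k : ℕ) : (k : ℝ) - 1 / 2 ≠ 0 := by
  intro h
  have h2 : ((2 * k : ℕ) : ℝ) = ((1 : ℕ) : ℝ) := by push_cast; linarith
  have := Nat.cast_injective h2
  omega

lemma halfCoeff_ne_zero (k : ℕ) : halfCoeff k ≠ 0 :=
  Finset.prod_ne_zero_iff.2 fun j _ => div_ne_zero (natCast_sub_half_ne_zero j) (by positivity)

lemma halfCoeff_succ_neg (k : ℕ) : halfCoeff (k + 1) < 0 := by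
  induction k with
  | zero => norm_num [halfCoeff_succ]
  | succ k ih =>
    rw [halfCoeff_succ]
    refine mul_neg_of_neg_of_pos ih ?_
    push_cast
    have : (0 : ℝ) ≤ k := k.cast_nonneg
    apply div_pos <;> linarith

lemma abs_halfCoeff_succ_le (k : ℕ) : |halfCoeff (k + 1)| ≤ 1 / 2 := by
  induction k with
  | zero => norm_num [halfCoeff_succ, abs_of_neg]
  | succ k ih =>
    rw [halfCoeff_succ, abs_mul]
    have h0 : (0 : ℝ) ≤ k := k.cast_nonneg
    have h1 : |(((k + 1 : ℕ) : ℝ) - 1 / 2) / (((k + 1 : ℕ) : ℝ) + 1)| ≤ 1 := by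
      push_cast
      rw [abs_of_pos (by apply div_pos <;> linarith), div_le_one (by linarith)]
      linarith
    calc _ ≤ |halfCoeff (k + 1)| * 1 := by gcongr
      _ ≤ 1 / 2 := by simpa using ih

/-- Partial sums are the coefficients after division by `1 - w`, here those of `(1 - w) ^ (-1 / 2)`.
-/
lemma sum_range_halfCoeff (k : ℕ) :
    ∑ j ∈ Finset.range (k + 1), halfCoeff j = -(2 * k - 1) * halfCoeff k := by
  induction k with
  | zero => simp
  | succ k ih =>
    rw [Finset.sum_range_succ, ih, halfCoeff_succ]
    push_cast
    field_simp
    ring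

/-- All coefficients after the leading `1` are negative, while the partial sums stay nonnegative. -/
lemma sum_range_abs_halfCoeff_succ_le (k : ℕ) :
    ∑ j ∈ Finset.range k, |halfCoeff (j + 1)| ≤ 1 := by
  have h1 : ∑ j ∈ Finset.range k, |halfCoeff (j + 1)|
      = -∑ j ∈ Finset.range k, halfCoeff (j + 1) := by
    rw [← Finset.sum_neg_distrib]
    exact Finset.sum_congr rfl fun j _ => abs_of_neg (halfCoeff_succ_neg j)
  have h2 := sum_range_halfCoeff k
  rw [Finset.sum_range_succ', halfCoeff_zero] at h2
  rcases k with _ | k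
  · simp
  · have h3 := halfCoeff_succ_neg k
    have h4 : (0 : ℝ) ≤ k := k.cast_nonneg
    push_cast at h2
    nlinarith

lemma summable_abs_halfCoeff : Summable fun k => |halfCoeff k| :=
  (summable_nat_add_iff 1).1 (summable_of_sum_range_le (c := 1) (fun _ => abs_nonneg _)
    sum_range_abs_halfCoeff_succ_le)

/-! ### Hypergeometric coefficients and their contiguous relation. -/

/-- The Taylor coefficients of `₂F₁(-1/2, n - 1/2; n + 1; w)`. -/
noncomputable def assocCoeff (n k : ℕ) : ℝ :=
  halfCoeff k * ∏ j ∈ Finset.range k, (((n : ℝ) + j - 1 / 2) / ((n : ℝ) + j + 1))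

@[simp] lemma assocCoeff_zero_right (n : ℕ) : assocCoeff n 0 = 1 := by simp [assocCoeff]

lemma assocCoeff_succ_right (n k : ℕ) : assocCoeff n (k + 1) =
    assocCoeff n k * (((k : ℝ) - 1 / 2) / ((k : ℝ) + 1)) *
      (((n : ℝ) + k - 1 / 2) / ((n : ℝ) + k + 1)) := by
  rw [assocCoeff, Finset.prod_range_succ, halfCoeff_succ, assocCoeff]
  ring

lemma assocCoeff_zero_left (k : ℕ) : assocCoeff 0 k = halfCoeff k ^ 2 := by
  simp [assocCoeff, halfCoeff, sq]

/-- Every factor of the extra product has modulus at most `1`. This yields one summable majorant for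
all `n` on the closed disc. -/
lemma abs_assocCoeff_le (n k : ℕ) : |assocCoeff n k| ≤ |halfCoeff k| := by
  rw [assocCoeff, abs_mul]
  refine mul_le_of_le_one_right (abs_nonneg _) ?_
  rw [Finset.abs_prod]
  refine Finset.prod_le_one (fun _ _ => abs_nonneg _) fun j _ => ?_
  have h0 : (0 : ℝ) ≤ n := n.cast_nonneg
  have h1 : (0 : ℝ) ≤ j := j.cast_nonneg
  rw [abs_div, abs_of_pos (by linarith : (0 : ℝ) < n + j + 1), div_le_one (by linarith), abs_le]
  constructor <;> linarith

lemma tendsto_assocCoeff (k : ℕ) :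
    Tendsto (fun n => assocCoeff n k) atTop (𝓝 (halfCoeff k)) := by
  have h : Tendsto (fun n : ℕ => ∏ j ∈ Finset.range k,
      (((n : ℝ) + j - 1 / 2) / ((n : ℝ) + j + 1))) atTop (𝓝 (∏ j ∈ Finset.range k, (1 : ℝ))) := by
    refine tendsto_finsetProd _ fun j _ => ?_
    have h1 : Tendsto (fun n : ℕ => 1 - (3 / 2 : ℝ) / ((n : ℝ) + j + 1)) atTop (𝓝 (1 - 0)) := by
      refine tendsto_const_nhds.sub (Tendsto.const_div_atTop ?_ _)
      simp only [add_assoc]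
      exact tendsto_atTop_add_const_right _ _ tendsto_natCast_atTop_atTop
    rw [sub_zero] at h1
    refine h1.congr fun n => ?_
    have : (n : ℝ) + j + 1 ≠ 0 := by positivity
    field_simp
    ring
  simpa [assocCoeff] using h.const_mul (halfCoeff k)

/-- Raising `n` by one shifts both Pochhammer symbols, and their quotients telescope. -/
lemma assocCoeff_succ_left (n k : ℕ) : assocCoeff (n + 1) k * (((n : ℝ) - 1 / 2) * (n + k + 1)) =
    assocCoeff n k * (((n : ℝ) + k - 1 / 2) * (n + 1)) := by
  induction k with
  | zero => simp
  | succ k ih =>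
    have h1 : (n : ℝ) + k + 1 ≠ 0 := by positivity
    have h2 : (n : ℝ) + 1 + k + 1 ≠ 0 := by positivity
    have h3 : (k : ℝ) + 1 ≠ 0 := by positivity
    have ih' : assocCoeff (n + 1) k * ((n : ℝ) - 1 / 2) =
      assocCoeff n k * (((n : ℝ) + k - 1 / 2) * (n + 1)) / (n + k + 1) := by
      rw [← ih]; field_simp
    rw [assocCoeff_succ_right, assocCoeff_succ_right]
    push_cast
    calc _ = assocCoeff (n + 1) k * ((n : ℝ) - 1 / 2) * (((k : ℝ) - 1 / 2) / ((k : ℝ) + 1)) *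
        (((n : ℝ) + 1 + k - 1 / 2) / ((n : ℝ) + 1 + k + 1)) * (n + (k + 1) + 1) := by ring
      _ = _ := by
        rw [ih']
        field_simp
        ring

/-- Gauss' contiguous relation on the level of coefficients. -/
lemma assocCoeff_contiguous (n k : ℕ) :
    ((n : ℝ) + 5 / 2) * (n + 1 / 2) / ((n + 1) * (n + 2)) * assocCoeff (n + 2) k =
      assocCoeff (n + 1) (k + 1) + assocCoeff (n + 1) k - assocCoeff n (k + 1) := by
  have h0 := natCast_sub_half_ne_zero n
  have h0' : (n : ℝ) + 1 - 1 / 2 ≠ 0 := by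
    have := natCast_sub_half_ne_zero (n + 1); push_cast at this; exact this
  have h1 : (n : ℝ) + k + 1 ≠ 0 := by positivity
  have h2 : (n : ℝ) + 1 + k + 1 ≠ 0 := by positivity
  have h3 : (k : ℝ) + 1 ≠ 0 := by positivity
  have h4 : (n : ℝ) + 1 ≠ 0 := by positivity
  have h5 : (n : ℝ) + 2 ≠ 0 := by positivity
  have e1 : assocCoeff (n + 1) k = assocCoeff n k * (((n : ℝ) + k - 1 / 2) * (n + 1)) /
      (((n : ℝ) - 1 / 2) * (n + k + 1)) := by
    rw [eq_div_iff (mul_ne_zero h0 h1), assocCoeff_succ_left]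
  have e2 : assocCoeff (n + 2) k = assocCoeff (n + 1) k * (((n : ℝ) + 1 + k - 1 / 2) * (n + 2)) /
      (((n : ℝ) + 1 - 1 / 2) * (n + 1 + k + 1)) := by
    have := assocCoeff_succ_left (n + 1) k
    push_cast at this
    rw [eq_div_iff (mul_ne_zero h0' h2), this]
    ring
  -- With `d` carrying both denominators, all three coefficients become explicit multiples of `d`.
  obtain ⟨d, hd⟩ : ∃ d, assocCoeff n k = d * (((n : ℝ) - 1 / 2) * (n + k + 1)) *
      (((n : ℝ) + 1 - 1 / 2) * (n + 1 + k + 1)) :=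
    ⟨assocCoeff n k / (((n : ℝ) - 1 / 2) * (n + k + 1)) /
      (((n : ℝ) + 1 - 1 / 2) * (n + 1 + k + 1)), by
        rw [mul_right_comm, div_mul_cancel₀ _ (mul_ne_zero h0' h2),
          div_mul_cancel₀ _ (mul_ne_zero h0 h1)]⟩
  have e1' : assocCoeff (n + 1) k = d * (((n : ℝ) + k - 1 / 2) * (n + 1)) *
      (((n : ℝ) + 1 - 1 / 2) * (n + 1 + k + 1)) := by
    rw [e1, hd, div_eq_iff (mul_ne_zero h0 h1)]
    ring
  have e2' : assocCoeff (n + 2) k = d * (((n : ℝ) + k - 1 / 2) * (n + 1)) *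
      (((n : ℝ) + 1 + k - 1 / 2) * (n + 2)) := by
    rw [e2, e1', div_eq_iff (mul_ne_zero h0' h2)]
    ring
  rw [assocCoeff_succ_right, assocCoeff_succ_right, e2', e1', hd]
  push_cast
  field_simp
  ring

/-! ### The hypergeometric functions on the closed disc. -/

/-- The function `₂F₁(-1/2, n - 1/2; n + 1; w)` on the closed unit disc. -/
noncomputable def assocFun (n : ℕ) (w : ℂ) : ℂ := ∑' k, (assocCoeff n k : ℂ) * w ^ k

/-- The function `(1 - w) ^ (1 / 2)` on the closed unit disc. -/
noncomputable def halfFun (w : ℂ) : ℂ := ∑' k, (halfCoeff k : ℂ) * w ^ k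

lemma norm_ofReal_mul_pow_le {c : ℕ → ℝ} (hc : ∀ k, |c k| ≤ |halfCoeff k|) {w : ℂ}
    (hw : ‖w‖ ≤ 1) (k : ℕ) : ‖(c k : ℂ) * w ^ k‖ ≤ |halfCoeff k| := by
  rw [norm_mul, norm_pow, Complex.norm_real, Real.norm_eq_abs]
  exact (mul_le_of_le_one_right (abs_nonneg _) (pow_le_one₀ (norm_nonneg _) hw)).trans (hc k)

lemma summable_ofReal_mul_pow {c : ℕ → ℝ} (hc : ∀ k, |c k| ≤ |halfCoeff k|) {w : ℂ}
    (hw : ‖w‖ ≤ 1) : Summable fun k => (c k : ℂ) * w ^ k :=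
  Summable.of_norm_bounded summable_abs_halfCoeff (norm_ofReal_mul_pow_le hc hw)

lemma continuousOn_tsum_ofReal_mul_pow {c : ℕ → ℝ} (hc : ∀ k, |c k| ≤ |halfCoeff k|) :
    ContinuousOn (fun w : ℂ => ∑' k, (c k : ℂ) * w ^ k) (Metric.closedBall 0 1) :=
  continuousOn_tsum (fun k => by fun_prop) summable_abs_halfCoeff
    fun k w hw => norm_ofReal_mul_pow_le hc (by simpa using hw) k

lemma continuousOn_assocFun (n : ℕ) : ContinuousOn (assocFun n) (Metric.closedBall 0 1) :=
  continuousOn_tsum_ofReal_mul_pow (abs_assocCoeff_le n)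

lemma continuousOn_halfFun : ContinuousOn halfFun (Metric.closedBall 0 1) :=
  continuousOn_tsum_ofReal_mul_pow fun _ => le_rfl

lemma differentiableOn_assocFun (n : ℕ) :
    DifferentiableOn ℂ (assocFun n) (Metric.ball 0 1) :=
  Complex.differentiableOn_tsum_of_summable_norm summable_abs_halfCoeff
    (fun k => by fun_prop) Metric.isOpen_ball
    fun k w hw => norm_ofReal_mul_pow_le (abs_assocCoeff_le n) (mem_ball_zero_iff.1 hw).le k

lemma assocFun_conj (n : ℕ) (w : ℂ) :
    assocFun n (starRingEnd ℂ w) = starRingEnd ℂ (assocFun n w) := by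
  simp [assocFun, Complex.conj_tsum]

lemma tendsto_assocFun {w : ℂ} (hw : ‖w‖ ≤ 1) :
    Tendsto (fun n => assocFun n w) atTop (𝓝 (halfFun w)) :=
  tendsto_tsum_of_dominated_convergence summable_abs_halfCoeff
    (fun k => ((Complex.continuous_ofReal.tendsto _).comp (tendsto_assocCoeff k)).mul_const _)
    (Eventually.of_forall fun n k => norm_ofReal_mul_pow_le (abs_assocCoeff_le n) hw k)

lemma assocFun_contiguous (n : ℕ) {w : ℂ} (hw : ‖w‖ ≤ 1) :
    ((n : ℂ) + 5 / 2) * (n + 1 / 2) / ((n + 1) * (n + 2)) * (w * assocFun (n + 2) w) =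
      (1 + w) * assocFun (n + 1) w - assocFun n w := by
  have hs := fun m => summable_ofReal_mul_pow (abs_assocCoeff_le m) hw
  have hs' := fun m => (summable_nat_add_iff 1).2 (hs m)
  have e : ∀ m, assocFun m w = 1 + ∑' k, (assocCoeff m (k + 1) : ℂ) * w ^ (k + 1) := by
    intro m
    rw [assocFun, (hs m).tsum_eq_zero_add]
    simp
  have e1 : (1 + w) * assocFun (n + 1) w - assocFun n w =
      ∑' k, ((assocCoeff (n + 1) (k + 1) : ℂ) * w ^ (k + 1) + w * (assocCoeff (n + 1) k * w ^ k)
        - assocCoeff n (k + 1) * w ^ (k + 1)) := by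
    rw [((hs' (n + 1)).add ((hs (n + 1)).mul_left w)).tsum_sub (hs' n),
      (hs' (n + 1)).tsum_add ((hs (n + 1)).mul_left w), tsum_mul_left, e n]
    have : w * ∑' k, (assocCoeff (n + 1) k : ℂ) * w ^ k = w * assocFun (n + 1) w := rfl
    rw [this, add_mul, one_mul]
    nth_rw 1 [e (n + 1)]
    ring
  rw [e1, assocFun, ← tsum_mul_left, ← tsum_mul_left]
  refine tsum_congr fun k => ?_
  have := congrArg (fun x : ℝ => (x : ℂ)) (assocCoeff_contiguous n k)
  push_cast at this
  linear_combination w ^ (k + 1) * this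

/-- The constant term `1` dominates: the other coefficients are squares of numbers of modulus at
most `1 / 2` whose moduli sum to at most `1`, so the tail is at most `1 / 2`. -/
lemma assocFun_zero_ne_zero {w : ℂ} (hw : ‖w‖ ≤ 1) : assocFun 0 w ≠ 0 := by
  have hs := summable_ofReal_mul_pow (abs_assocCoeff_le 0) hw
  have h1 : assocFun 0 w = 1 + ∑' k, (assocCoeff 0 (k + 1) : ℂ) * w ^ (k + 1) := by
    rw [assocFun, hs.tsum_eq_zero_add]
    simp
  have hb : ∀ k, ‖(assocCoeff 0 (k + 1) : ℂ) * w ^ (k + 1)‖ ≤ 1 / 2 * |halfCoeff (k + 1)| := by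
    intro k
    rw [norm_mul, norm_pow, Complex.norm_real, Real.norm_eq_abs, assocCoeff_zero_left, abs_pow, sq]
    refine (mul_le_of_le_one_right (by positivity) (pow_le_one₀ (norm_nonneg _) hw)).trans ?_
    gcongr
    exact abs_halfCoeff_succ_le k
  have hs1 := ((summable_nat_add_iff 1).2 summable_abs_halfCoeff).mul_left (1 / 2)
  have h2 := tsum_of_norm_bounded hs1.hasSum hb
  rw [tsum_mul_left] at h2
  have h3 : ∑' k, |halfCoeff (k + 1)| ≤ 1 :=
    Real.tsum_le_of_sum_range_le (fun _ => abs_nonneg _) sum_range_abs_halfCoeff_succ_le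
  intro h
  rw [h1] at h
  rw [eq_neg_of_add_eq_zero_right h, norm_neg, norm_one] at h2
  linarith

lemma choose_half_mul_neg_one_pow (k : ℕ) :
    Ring.choose (1 / 2 : ℂ) k * (-1) ^ k = (halfCoeff k : ℂ) := by
  induction k with
  | zero => simp
  | succ k ih =>
    have h : Ring.choose (1 / 2 : ℂ) (k + 1) * (k + 1) = Ring.choose (1 / 2 : ℂ) k * (1 / 2 - k) := by
      rw [Ring.choose_eq_smul, Ring.choose_eq_smul, descPochhammer_succ_right, smeval_mul,
        smeval_sub, smeval_X, smeval_natCast, Nat.factorial_succ]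
      have hk : (k : ℂ) + 1 ≠ 0 := by exact_mod_cast k.succ_ne_zero
      have hf : (k.factorial : ℂ) ≠ 0 := by exact_mod_cast k.factorial_ne_zero
      simp
      field_simp
    rw [halfCoeff_succ]
    push_cast
    have hk : (k : ℂ) + 1 ≠ 0 := by exact_mod_cast k.succ_ne_zero
    rw [← ih, ← mul_div_assoc, eq_div_iff hk]
    linear_combination (-1) ^ (k + 1) * h

/-- The binomial series gives this in the open disc; continuity carries it to the circle, where it
is needed. -/
lemma halfFun_sq {w : ℂ} (hw : ‖w‖ ≤ 1) : halfFun w ^ 2 = 1 - w := by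
  have h : EqOn (fun w => halfFun w ^ 2) (fun w => 1 - w) (Metric.ball 0 1) := by
    intro w hw
    have hw' : -w ∈ Metric.eball (0 : ℂ) 1 := by
      simpa [← ENNReal.ofReal_one, Metric.eball_ofReal] using hw
    have h1 := (Complex.one_add_cpow_hasFPowerSeriesOnBall_zero (a := 1 / 2)).hasSum hw'
    have h2 : halfFun w = (1 + -w) ^ (1 / 2 : ℂ) := by
      rw [zero_add] at h1
      rw [← h1.tsum_eq, halfFun]
      refine tsum_congr fun k => ?_
      rw [← choose_half_mul_neg_one_pow, binomialSeries_apply]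
      simp [neg_pow w]
      ring
    simp only
    rw [h2, ← Complex.cpow_nat_mul]
    simp [sub_eq_add_neg]
  exact h.of_subset_closure (continuousOn_halfFun.pow 2) (by fun_prop) Metric.ball_subset_closedBall
    (by rw [closure_ball _ one_ne_zero]) (by simpa using hw)

/-! ### Euler's transformation and the radial limit. -/

lemma summable_norm_and_tsum_div_one_sub {b : ℕ → ℂ} {w : ℂ} (hw : ‖w‖ < 1)
    (hb : Summable fun k => ‖b k * w ^ k‖) :
    (Summable fun k => ‖(∑ j ∈ Finset.range (k + 1), b j) * w ^ k‖) ∧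
      ∑' k, (∑ j ∈ Finset.range (k + 1), b j) * w ^ k = (∑' k, b k * w ^ k) / (1 - w) := by
  have hg : Summable fun k : ℕ => ‖w ^ k‖ := by
    simpa [norm_pow] using summable_geometric_of_lt_one (norm_nonneg w) hw
  have e : ∀ k, ∑ j ∈ Finset.range (k + 1), b j * w ^ j * w ^ (k - j) =
      (∑ j ∈ Finset.range (k + 1), b j) * w ^ k := by
    intro k
    rw [Finset.sum_mul]
    refine Finset.sum_congr rfl fun j hj => ?_
    rw [mul_assoc, ← pow_add, Nat.add_sub_cancel' (Nat.lt_succ_iff.1 (Finset.mem_range.1 hj))]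
  constructor
  · simpa only [e] using summable_norm_sum_mul_range_of_summable_norm hb hg
  · rw [div_eq_mul_inv, ← tsum_geometric_of_norm_lt_one hw,
      tsum_mul_tsum_eq_tsum_sum_range_of_summable_norm hb hg]
    exact (tsum_congr e).symm

lemma sum_range_halfCoeff_sq (k : ℕ) : ∑ j ∈ Finset.range (k + 1), halfCoeff j ^ 2 =
    (2 * k - 1) ^ 2 * (4 * k + 1) * halfCoeff k ^ 2 := by
  induction k with
  | zero => simp
  | succ k ih =>
    rw [Finset.sum_range_succ, ih, halfCoeff_succ]
    push_cast
    field_simp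
    ring

/-- Double partial sums correspond to division by `(1 - w) ^ 2`; the result is `((3/2)_k / k!) ^ 2`,
the coefficient of `₂F₁(3/2, 3/2; 1; w)`. -/
lemma sum_range_sum_halfCoeff_sq (k : ℕ) :
    ∑ j ∈ Finset.range (k + 1), ∑ i ∈ Finset.range (j + 1), halfCoeff i ^ 2 =
      ((2 * k + 1) * (2 * k - 1) * halfCoeff k) ^ 2 := by
  simp_rw [sum_range_halfCoeff_sq]
  induction k with
  | zero => simp
  | succ k ih =>
    rw [Finset.sum_range_succ, ih, halfCoeff_succ]
    push_cast
    field_simp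
    ring

lemma ascPochhammer_eval_three_halves (k : ℕ) : (ascPochhammer ℂ k).eval (3 / 2) =
    -(k.factorial * ((2 * k + 1) * (2 * k - 1) * halfCoeff k : ℝ)) := by
  induction k with
  | zero => simp
  | succ k ih =>
    have hk : (k : ℂ) + 1 ≠ 0 := by exact_mod_cast k.succ_ne_zero
    rw [ascPochhammer_succ_eval, ih, halfCoeff_succ, Nat.factorial_succ]
    push_cast
    field_simp
    ring

lemma hypergeometric_three_halves {w : ℂ} (hw : ‖w‖ < 1) :
    ₂F₁ (3 / 2 : ℂ) (3 / 2) 1 w = assocFun 0 w / (1 - w) ^ 2 := by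
  have h0 : Summable fun k => ‖((halfCoeff k ^ 2 : ℝ) : ℂ) * w ^ k‖ := by
    simp_rw [← assocCoeff_zero_left]
    exact Summable.of_nonneg_of_le (fun _ => norm_nonneg _)
      (norm_ofReal_mul_pow_le (abs_assocCoeff_le 0) hw.le) summable_abs_halfCoeff
  obtain ⟨h1, e1⟩ := summable_norm_and_tsum_div_one_sub hw h0
  obtain ⟨-, e2⟩ := summable_norm_and_tsum_div_one_sub hw h1
  rw [e1] at e2
  have e3 : assocFun 0 w = ∑' k, ((halfCoeff k ^ 2 : ℝ) : ℂ) * w ^ k := by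
    simp_rw [assocFun, assocCoeff_zero_left]
  rw [e3, sq (1 - w), ← div_div, ← e2, ordinaryHypergeometric_eq_tsum]
  refine tsum_congr fun k => ?_
  have hf : (k.factorial : ℂ) ≠ 0 := by exact_mod_cast k.factorial_ne_zero
  have := congrArg (fun x : ℝ => (x : ℂ)) (sum_range_sum_halfCoeff_sq k)
  simp only [Complex.ofReal_sum] at this
  rw [this, ascPochhammer_eval_three_halves, ascPochhammer_eval_one, smul_eq_mul]
  push_cast
  field_simp

lemma hypBoundary_three_halves {z : ℂ} (hz : ‖z‖ = 1) (hz1 : z ≠ 1) :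
    hypBoundary (3 / 2) (3 / 2) 1 z = assocFun 0 z / (1 - z) ^ 2 := by
  refine Tendsto.limUnder_eq ?_
  have hmem : ∀ r ∈ Ioo (0 : ℝ) 1, ‖(r : ℂ) * z‖ < 1 := by
    intro r hr
    rw [norm_mul, hz, mul_one, Complex.norm_real, Real.norm_eq_abs, abs_of_pos hr.1]
    exact hr.2
  have hev : ∀ᶠ r : ℝ in 𝓝[<] 1, r ∈ Ioo (0 : ℝ) 1 := Ioo_mem_nhdsLT one_pos
  have h1 : Tendsto (fun r : ℝ => (r : ℂ) * z) (𝓝[<] 1) (𝓝 z) := by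
    have : Continuous fun r : ℝ => (r : ℂ) * z := by fun_prop
    simpa using (this.tendsto 1).mono_left nhdsWithin_le_nhds
  have h2 : Tendsto (fun r : ℝ => (r : ℂ) * z) (𝓝[<] 1) (𝓝[Metric.closedBall 0 1] z) := by
    refine tendsto_nhdsWithin_iff.2 ⟨h1, hev.mono fun r hr => ?_⟩
    simpa using (hmem r hr).le
  have h3 := (continuousOn_assocFun 0 z (by simp [hz])).tendsto.comp h2
  have h4 := h3.div ((h1.const_sub 1).pow 2) (pow_ne_zero 2 (sub_ne_zero.2 hz1.symm))
  exact h4.congr' (hev.mono fun r hr => (hypergeometric_three_halves (hmem r hr)).symm)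

lemma norm_exp_two_mul_I_mul (t : ℝ) : ‖Complex.exp (2 * Complex.I * t)‖ = 1 := by
  rw [show 2 * Complex.I * (t : ℂ) = ((2 * t : ℝ) : ℂ) * Complex.I by push_cast; ring]
  exact Complex.norm_exp_ofReal_mul_I _

lemma norm_one_sub_exp_two_mul_I_mul {t : ℝ} (ht : t ∈ Ioo 0 Real.pi) :
    ‖1 - Complex.exp (2 * Complex.I * t)‖ = 2 * Real.sin t := by
  have hs := Real.sin_pos_of_mem_Ioo ht
  have h := Complex.norm_exp_I_mul_ofReal_sub_one (2 * t)
  rw [mul_div_cancel_left₀ _ two_ne_zero, Real.norm_of_nonneg (by positivity)] at h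
  rw [norm_sub_rev, ← h]
  congr 3
  push_cast
  ring

/-! ### The weight in terms of `assocFun 0`. -/

/-- The normalization of the weight `ultrasphericalWeight (-1 / 2) (3 / 2)`. -/
noncomputable def weightConst : ℝ :=
  4 * (Real.Gamma 1 ^ 2 / (2 * Real.pi * Real.Gamma (1 / 2) * Real.Gamma (5 / 2)))

lemma weightConst_pos : 0 < weightConst := by
  have h1 := Real.Gamma_pos_of_pos (show (0 : ℝ) < 1 / 2 by norm_num)
  have h2 := Real.Gamma_pos_of_pos (show (0 : ℝ) < 5 / 2 by norm_num)
  have h3 := Real.Gamma_pos_of_pos (show (0 : ℝ) < 1 by norm_num)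
  have := Real.pi_pos
  unfold weightConst
  positivity

/-- The transformation contributes `|1 - exp(2it)| ^ 4 = (2 sin t) ^ 4`. Against the prefactor `(2
sin t) ^ (-2)` this leaves `4 sin² t`, whose `4` sits in `weightConst`. -/
lemma ultrasphericalWeight_cos {t : ℝ} (ht : t ∈ Ioo 0 Real.pi) :
    ultrasphericalWeight (-1 / 2) (3 / 2) (Real.cos t) =
      weightConst * (Real.sin t ^ 2 / ‖assocFun 0 (Complex.exp (2 * Complex.I * t))‖ ^ 2) := by
  have hs := Real.sin_pos_of_mem_Ioo ht
  have hx : Real.cos t ∈ Ioo (-1 : ℝ) 1 := by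
    constructor
    · rw [← Real.cos_pi]
      exact Real.cos_lt_cos_of_nonneg_of_le_pi ht.1.le le_rfl ht.2
    · rw [← Real.cos_zero]
      exact Real.cos_lt_cos_of_nonneg_of_le_pi le_rfl ht.2.le ht.1
  have hn := norm_one_sub_exp_two_mul_I_mul ht
  have hz := norm_exp_two_mul_I_mul t
  have hz1 : Complex.exp (2 * Complex.I * t) ≠ 1 := by
    intro h
    rw [h] at hn
    simp at hn
    linarith
  have hA := norm_pos_iff.2 (assocFun_zero_ne_zero hz.le)
  rw [ultrasphericalWeight, if_pos hx, Real.arccos_cos ht.1.le ht.2.le,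
    show (1 : ℂ) - ((-1 / 2 : ℝ) : ℂ) = 3 / 2 by push_cast; norm_num,
    show ((3 / 2 : ℝ) : ℂ) = 3 / 2 by push_cast; norm_num,
    show (3 / 2 : ℂ) + ((-1 / 2 : ℝ) : ℂ) = 1 by push_cast; norm_num,
    hypBoundary_three_halves hz hz1, norm_div, norm_pow, hn, weightConst]
  norm_num
  have h1 := Real.Gamma_pos_of_pos (show (0 : ℝ) < 1 / 2 by norm_num)
  have h2 := Real.Gamma_pos_of_pos (show (0 : ℝ) < 5 / 2 by norm_num)
  have := Real.pi_pos
  field_simp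
  norm_num

/-- A continuous extension of the weight beyond `(-1, 1)`. -/
noncomputable def weightExtension (x : ℝ) : ℝ :=
  weightConst * ((1 - x ^ 2) / ‖assocFun 0 (Complex.exp (2 * Complex.I * Real.arccos x))‖ ^ 2)

lemma continuous_weightExtension : Continuous weightExtension := by
  have h : Continuous fun x : ℝ => assocFun 0 (Complex.exp (2 * Complex.I * Real.arccos x)) :=
    (continuousOn_assocFun 0).comp_continuous
      (by have := Real.continuous_arccos; fun_prop) fun x => by simp [norm_exp_two_mul_I_mul]
  refine continuous_const.mul (Continuous.div (by fun_prop) (by fun_prop) fun x => ?_)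
  exact pow_ne_zero 2 (norm_ne_zero_iff.2 (assocFun_zero_ne_zero (norm_exp_two_mul_I_mul _).le))

lemma ultrasphericalWeight_eq_indicator : ultrasphericalWeight (-1 / 2) (3 / 2) =
    (Ioo (-1 : ℝ) 1).indicator weightExtension := by
  ext x
  by_cases hx : x ∈ Ioo (-1 : ℝ) 1
  · have ht : Real.arccos x ∈ Ioo 0 Real.pi :=
      ⟨Real.arccos_pos.2 hx.2, Real.arccos_lt_pi.2 hx.1⟩
    have h := ultrasphericalWeight_cos ht
    rw [Real.cos_arccos hx.1.le hx.2.le] at h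
    rw [indicator_of_mem hx, h, weightExtension, Real.sin_sq, Real.cos_arccos hx.1.le hx.2.le]
  · rw [indicator_of_notMem hx, ultrasphericalWeight, if_neg hx]

lemma weightExtension_pos {x : ℝ} (hx : x ∈ Ioo (-1 : ℝ) 1) : 0 < weightExtension x := by
  have h : 0 < 1 - x ^ 2 := by nlinarith [hx.1, hx.2]
  have hA := norm_pos_iff.2 (assocFun_zero_ne_zero (norm_exp_two_mul_I_mul (Real.arccos x)).le)
  have := weightConst_pos
  unfold weightExtension
  positivity

lemma isWeight_ultrasphericalWeight : IsWeight (ultrasphericalWeight (-1 / 2) (3 / 2)) := by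
  rw [ultrasphericalWeight_eq_indicator]
  refine ⟨fun x => indicator_nonneg (fun x hx => (weightExtension_pos hx).le) x, fun n => ?_, ?_⟩
  · have h : (fun x : ℝ => x ^ n * (Ioo (-1 : ℝ) 1).indicator weightExtension x) =
        (Ioo (-1 : ℝ) 1).indicator fun x => x ^ n * weightExtension x := by
      ext x
      by_cases hx : x ∈ Ioo (-1 : ℝ) 1 <;> simp [hx]
    rw [h, integrable_indicator_iff measurableSet_Ioo]
    have hc : Continuous fun x : ℝ => x ^ n * weightExtension x :=
      (continuous_pow n).mul continuous_weightExtension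
    exact hc.integrableOn_Icc.mono_set Ioo_subset_Icc_self
  · refine lt_of_lt_of_le ?_ (measure_mono (s := Ioo (-1 : ℝ) 1) fun x hx => ?_)
    · simp
    · rw [Function.mem_support, indicator_of_mem hx]
      exact (weightExtension_pos hx).ne'

/-! ### The minimal solution and its Casoratian. -/

lemma halfCoeff_succ_mul (k : ℕ) :
    halfCoeff (k + 1) * ((k : ℝ) + 1) = halfCoeff k * ((k : ℝ) - 1 / 2) := by
  rw [halfCoeff_succ, mul_assoc, div_mul_cancel₀ _ (by positivity)]

/-- A solution of the recurrence of the `q n`, shifted by one, that decays as `n → ∞` for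
`‖z‖ < 1`. -/
noncomputable def minimalSol (n : ℕ) (z : ℂ) : ℂ := halfCoeff n * z ^ n * assocFun n (z ^ 2)

lemma minimalSol_succ_succ (n : ℕ) {z : ℂ} (hz : ‖z‖ = 1) :
    ((n : ℂ) + 5 / 2) * minimalSol (n + 2) z =
      (z + z⁻¹) * (n + 1) * minimalSol (n + 1) z - (n - 1 / 2) * minimalSol n z := by
  have hz0 : z ≠ 0 := norm_ne_zero_iff.1 (by rw [hz]; exact one_ne_zero)
  have h1 : (n : ℂ) + 1 ≠ 0 := by exact_mod_cast n.succ_ne_zero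
  have h2 : (n : ℂ) + 2 ≠ 0 := by
    have : ((n + 2 : ℕ) : ℂ) ≠ 0 := Nat.cast_ne_zero.2 (by omega)
    exact_mod_cast this
  have h := assocFun_contiguous n (w := z ^ 2) (by rw [norm_pow, hz, one_pow])
  rw [div_mul_eq_mul_div, div_eq_iff (mul_ne_zero h1 h2)] at h
  have e1 := congrArg (fun x : ℝ => (x : ℂ)) (halfCoeff_succ_mul n)
  have e2 := congrArg (fun x : ℝ => (x : ℂ)) (halfCoeff_succ_mul (n + 1))
  have e3 := mul_inv_cancel₀ hz0
  push_cast at e1 e2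
  unfold minimalSol
  refine mul_left_cancel₀ h2 ?_
  linear_combination halfCoeff (n + 1) * z ^ n * h +
    ((n : ℂ) + 5 / 2) * z ^ (n + 2) * assocFun (n + 2) (z ^ 2) * e2 -
    ((n : ℂ) + 2) * z ^ n * assocFun n (z ^ 2) * e1 -
    ((n : ℂ) + 2) * (n + 1) * halfCoeff (n + 1) * z ^ n * assocFun (n + 1) (z ^ 2) * e3

/-- The Casoratian of the minimal solution and its complex conjugate, up to normalization. -/
noncomputable def casoratian (n : ℕ) (z : ℂ) : ℝ :=
  (z * assocFun (n + 1) (z ^ 2) * starRingEnd ℂ (assocFun n (z ^ 2))).im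

lemma im_minimalSol_mul_conj (n : ℕ) {z : ℂ} (hz : ‖z‖ = 1) :
    (minimalSol (n + 1) z * starRingEnd ℂ (minimalSol n z)).im =
      halfCoeff (n + 1) * halfCoeff n * casoratian n z := by
  have h : z ^ n * starRingEnd ℂ (z ^ n) = 1 := by
    rw [Complex.mul_conj, Complex.normSq_eq_norm_sq, norm_pow, hz]
    simp
  have e : minimalSol (n + 1) z * starRingEnd ℂ (minimalSol n z) =
      ((halfCoeff (n + 1) * halfCoeff n : ℝ) : ℂ) *
        (z * assocFun (n + 1) (z ^ 2) * starRingEnd ℂ (assocFun n (z ^ 2))) := by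
    simp only [minimalSol, map_mul, Complex.conj_ofReal]
    push_cast
    linear_combination (halfCoeff (n + 1) * halfCoeff n *
        (z * assocFun (n + 1) (z ^ 2) * starRingEnd ℂ (assocFun n (z ^ 2))) : ℂ) * h
  rw [e, Complex.im_ofReal_mul, casoratian]

lemma add_inv_eq_two_mul_re {z : ℂ} (hz : ‖z‖ = 1) : z + z⁻¹ = ((2 * z.re : ℝ) : ℂ) := by
  rw [Complex.inv_eq_conj hz, Complex.add_conj]

/-- Multiply the recurrence by the conjugate of `minimalSol (n + 1) z` and take imaginary parts: the
middle term is real and drops out. The resulting factor does not depend on `z`. -/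
lemma casoratian_succ (n : ℕ) {z : ℂ} (hz : ‖z‖ = 1) : casoratian (n + 1) z =
    ((n : ℝ) + 1) * (n + 2) / ((n + 1 / 2) * (n + 5 / 2)) * casoratian n z := by
  have h := congrArg (fun x => (x * starRingEnd ℂ (minimalSol (n + 1) z)).im)
    (minimalSol_succ_succ n hz)
  rw [add_inv_eq_two_mul_re hz] at h
  have e1 : ((n : ℂ) + 5 / 2) * minimalSol (n + 2) z * starRingEnd ℂ (minimalSol (n + 1) z) =
      (((n : ℝ) + 5 / 2 : ℝ) : ℂ) *
        (minimalSol (n + 2) z * starRingEnd ℂ (minimalSol (n + 1) z)) := by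
    push_cast; ring
  have e2 : (((2 * z.re : ℝ) : ℂ) * (n + 1) * minimalSol (n + 1) z -
      (n - 1 / 2) * minimalSol n z) * starRingEnd ℂ (minimalSol (n + 1) z) =
      ((2 * z.re * (n + 1) * ‖minimalSol (n + 1) z‖ ^ 2 : ℝ) : ℂ) - (((n : ℝ) - 1 / 2 : ℝ) : ℂ) *
        starRingEnd ℂ (minimalSol (n + 1) z * starRingEnd ℂ (minimalSol n z)) := by
    have := Complex.mul_conj' (minimalSol (n + 1) z)
    simp only [map_mul, Complex.conj_conj]
    push_cast
    linear_combination (2 * z.re * (n + 1) : ℂ) * this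
  simp only [e1, e2, Complex.sub_im, Complex.im_ofReal_mul, Complex.ofReal_im, Complex.conj_im] at h
  rw [im_minimalSol_mul_conj (n + 1) hz, im_minimalSol_mul_conj n hz] at h
  have e3 := halfCoeff_succ_mul n
  have e4 := halfCoeff_succ_mul (n + 1)
  push_cast at e4
  rw [div_mul_eq_mul_div, eq_div_iff (by positivity)]
  refine mul_left_cancel₀ (pow_ne_zero 2 (halfCoeff_ne_zero (n + 1))) ?_
  linear_combination ((n : ℝ) + 2) * h -
    ((n : ℝ) + 5 / 2) * halfCoeff (n + 1) * casoratian (n + 1) z * e4 -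
    ((n : ℝ) + 2) * halfCoeff (n + 1) * casoratian n z * e3

lemma casoratian_eq (z : ℂ) (hz : ‖z‖ = 1) (n : ℕ) : casoratian n z =
    (∏ j ∈ Finset.range n, (((j : ℝ) + 1) * (j + 2) / ((j + 1 / 2) * (j + 5 / 2)))) *
      casoratian 0 z := by
  induction n with
  | zero => simp
  | succ n ih => rw [casoratian_succ n hz, ih, Finset.prod_range_succ]; ring

lemma exp_mul_I_sq (t : ℝ) :
    Complex.exp (t * Complex.I) ^ 2 = Complex.exp (2 * Complex.I * t) := by
  rw [← Complex.exp_nat_mul]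
  congr 1
  push_cast
  ring

/-- In the limit both functions become `halfFun (z ^ 2)`, leaving `Im z · |1 - z²| = sin t · 2 sin
t`. -/
lemma tendsto_casoratian {t : ℝ} (ht : t ∈ Ioo 0 Real.pi) :
    Tendsto (fun n => casoratian n (Complex.exp (t * Complex.I))) atTop
      (𝓝 (2 * Real.sin t ^ 2)) := by
  set z := Complex.exp (t * Complex.I) with hz
  have hz1 : ‖z ^ 2‖ = 1 := by rw [hz, exp_mul_I_sq, norm_exp_two_mul_I_mul]
  have h1 := tendsto_assocFun hz1.le
  have h2 := (h1.comp (tendsto_add_atTop_nat 1)).const_mul z |>.mul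
    ((Complex.continuous_conj.tendsto _).comp h1)
  have h3 := (Complex.continuous_im.tendsto _).comp h2
  have h4 : ‖halfFun (z ^ 2)‖ ^ 2 = 2 * Real.sin t := by
    rw [← norm_pow, halfFun_sq hz1.le, hz, exp_mul_I_sq, norm_one_sub_exp_two_mul_I_mul ht]
  have h5 : (z * halfFun (z ^ 2) * starRingEnd ℂ (halfFun (z ^ 2))).im = 2 * Real.sin t ^ 2 := by
    rw [mul_assoc, Complex.mul_conj', ← Complex.ofReal_pow, h4, Complex.im_mul_ofReal, hz,
      Complex.exp_ofReal_mul_I_im]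
    ring
  rw [h5] at h3
  exact h3

/-- The product linking index `0` to index `n` is the same for all `t`, so comparing limits at `t`
and at `π / 2` avoids computing it. -/
lemma exists_casoratian_zero : ∃ κ : ℝ, κ ≠ 0 ∧ ∀ t ∈ Ioo 0 Real.pi,
    casoratian 0 (Complex.exp (t * Complex.I)) = κ * Real.sin t ^ 2 := by
  have hpi : Real.pi / 2 ∈ Ioo 0 Real.pi := by constructor <;> linarith [Real.pi_pos]
  set c := casoratian 0 (Complex.exp ((Real.pi / 2 : ℝ) * Complex.I)) with hc
  have h1 := (tendsto_casoratian hpi).congr (casoratian_eq _ (Complex.norm_exp_ofReal_mul_I _))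
  rw [Real.sin_pi_div_two, ← hc] at h1
  refine ⟨c, fun h => ?_, fun t ht => ?_⟩
  · rw [h] at h1
    simp only [mul_zero] at h1
    have := tendsto_nhds_unique h1 tendsto_const_nhds
    norm_num at this
  · have h2 := (tendsto_casoratian ht).congr (casoratian_eq _ (Complex.norm_exp_ofReal_mul_I t))
    have h3 := tendsto_nhds_unique
      ((h1.mul_const (casoratian 0 (Complex.exp (t * Complex.I)))).congr fun n => by ring)
      (h2.mul_const c)
    linarith

lemma im_minimalSol_mul_conj_zero (n : ℕ) {z : ℂ} (hz : ‖z‖ = 1) :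
    (((minimalSol (n + 1) z * starRingEnd ℂ (minimalSol 0 z)).im : ℝ) : ℂ) =
      (q n).eval (z.re : ℂ) * ((-1 / 2 * casoratian 0 z : ℝ) : ℂ) := by
  have hr : ∀ n : ℕ, ((n : ℂ) + 5 / 2) *
      (((minimalSol (n + 2) z * starRingEnd ℂ (minimalSol 0 z)).im : ℝ) : ℂ) =
      2 * (z.re : ℂ) * (n + 1) *
        (((minimalSol (n + 1) z * starRingEnd ℂ (minimalSol 0 z)).im : ℝ) : ℂ) -
      (n - 1 / 2) * (((minimalSol n z * starRingEnd ℂ (minimalSol 0 z)).im : ℝ) : ℂ) := by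
    intro n
    have h := congrArg (fun x => (x * starRingEnd ℂ (minimalSol 0 z)).im)
      (minimalSol_succ_succ n hz)
    rw [add_inv_eq_two_mul_re hz] at h
    have e1 : ((n : ℂ) + 5 / 2) * minimalSol (n + 2) z * starRingEnd ℂ (minimalSol 0 z) =
        (((n : ℝ) + 5 / 2 : ℝ) : ℂ) *
          (minimalSol (n + 2) z * starRingEnd ℂ (minimalSol 0 z)) := by
      push_cast; ring
    have e2 : (((2 * z.re : ℝ) : ℂ) * (n + 1) * minimalSol (n + 1) z -
        (n - 1 / 2) * minimalSol n z) * starRingEnd ℂ (minimalSol 0 z) =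
        ((2 * z.re * (n + 1) : ℝ) : ℂ) *
          (minimalSol (n + 1) z * starRingEnd ℂ (minimalSol 0 z)) -
        (((n : ℝ) - 1 / 2 : ℝ) : ℂ) * (minimalSol n z * starRingEnd ℂ (minimalSol 0 z)) := by
      push_cast; ring
    simp only [e1, e2, Complex.sub_im, Complex.im_ofReal_mul] at h
    have h' := congrArg (fun x : ℝ => (x : ℂ)) h
    push_cast at h'
    exact h'
  have h1 : (minimalSol 1 z * starRingEnd ℂ (minimalSol 0 z)).im = -1 / 2 * casoratian 0 z := by
    have := im_minimalSol_mul_conj 0 hz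
    rw [zero_add] at this
    rw [this, halfCoeff_succ]
    norm_num
  have h0 : (minimalSol 0 z * starRingEnd ℂ (minimalSol 0 z)).im = 0 := by
    rw [Complex.mul_conj, Complex.ofReal_im]
  induction n using Nat.twoStepInduction with
  | zero => rw [zero_add, h1, q_zero, eval_one, one_mul]
  | one =>
    have h := hr 0
    rw [h0, zero_add, zero_add, h1] at h
    rw [q_one]
    simp only [eval_mul, eval_C, eval_X]
    push_cast at h ⊢
    linear_combination 2 / 5 * h
  | more n ih1 ih2 =>
    have h := hr (n + 1)
    have h2 := eval_q_succ_succ n (z.re : ℂ)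
    rw [show n + 1 + 2 = n + 2 + 1 by ring, ih2, ih1] at h
    refine mul_left_cancel₀ (natCast_add_seven_halves_ne_zero n) ?_
    push_cast at h ⊢
    linear_combination h - (-1 / 2 * casoratian 0 z : ℂ) * h2

/-! ### Orthogonality by Cauchy's theorem. -/

/-- The quotient of `assocFun (n + 1)` by `assocFun 0`. -/
noncomputable def assocQuot (n : ℕ) (w : ℂ) : ℂ := assocFun (n + 1) w / assocFun 0 w

lemma continuousOn_assocQuot (n : ℕ) : ContinuousOn (assocQuot n) (Metric.closedBall 0 1) :=
  (continuousOn_assocFun (n + 1)).div (continuousOn_assocFun 0) fun _ hw =>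
    assocFun_zero_ne_zero (by simpa using hw)

lemma differentiableOn_assocQuot (n : ℕ) : DifferentiableOn ℂ (assocQuot n) (Metric.ball 0 1) :=
  (differentiableOn_assocFun (n + 1)).div (differentiableOn_assocFun 0) fun _ hw =>
    assocFun_zero_ne_zero (mem_ball_zero_iff.1 hw).le

lemma assocQuot_conj (n : ℕ) (w : ℂ) :
    assocQuot n (starRingEnd ℂ w) = starRingEnd ℂ (assocQuot n w) := by
  simp [assocQuot, assocFun_conj]

lemma weightExtension_cos {t : ℝ} (ht : t ∈ Icc 0 Real.pi) : weightExtension (Real.cos t) =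
    weightConst * (Real.sin t ^ 2 / ‖assocFun 0 (Complex.exp (2 * Complex.I * t))‖ ^ 2) := by
  rw [weightExtension, Real.arccos_cos ht.1 ht.2, Real.sin_sq]

/-- The `sin² t` of the weight cancels that of the Casoratian, and `conj F_0 / |F_0|² = 1 / F_0`. -/
lemma exists_eval_q_mul_weight (n : ℕ) : ∃ K : ℂ, ∀ t ∈ Ioo 0 Real.pi,
    (q n).eval (Real.cos t : ℂ) * (weightExtension (Real.cos t) : ℂ) =
      K * ((Complex.exp (t * Complex.I) ^ (n + 1) *
        assocQuot n (Complex.exp (t * Complex.I) ^ 2)).im : ℝ) := by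
  obtain ⟨κ, hκ, hc⟩ := exists_casoratian_zero
  refine ⟨(weightConst * halfCoeff (n + 1) * (-2 / κ) : ℝ), fun t ht => ?_⟩
  set z := Complex.exp (t * Complex.I) with hz
  have hz1 : ‖z‖ = 1 := Complex.norm_exp_ofReal_mul_I t
  have hre : z.re = Real.cos t := Complex.exp_ofReal_mul_I_re t
  have h := im_minimalSol_mul_conj_zero n hz1
  rw [hc t ht, hre] at h
  have hA : assocFun 0 (z ^ 2) ≠ 0 := assocFun_zero_ne_zero (by simp [hz1])
  have e1 : minimalSol (n + 1) z * starRingEnd ℂ (minimalSol 0 z) =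
      ((halfCoeff (n + 1) * ‖assocFun 0 (z ^ 2)‖ ^ 2 : ℝ) : ℂ) *
        (z ^ (n + 1) * assocQuot n (z ^ 2)) := by
    have h2 := Complex.mul_conj' (assocFun 0 (z ^ 2))
    simp only [minimalSol, assocQuot]
    push_cast
    rw [← h2]
    field_simp
    simp
  rw [e1, Complex.im_ofReal_mul] at h
  rw [weightExtension_cos (Ioo_subset_Icc_self ht), ← exp_mul_I_sq, ← hz]
  have hκ' : (κ : ℂ) ≠ 0 := Complex.ofReal_ne_zero.2 hκ
  have hA' : (‖assocFun 0 (z ^ 2)‖ : ℂ) ≠ 0 := Complex.ofReal_ne_zero.2 (norm_ne_zero_iff.2 hA)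
  push_cast at h ⊢
  field_simp
  linear_combination (2 * weightConst : ℂ) * h

lemma integral_add_comp_neg_of_periodic {g : ℝ → ℂ} (hg : Continuous g)
    (hp : Function.Periodic g (2 * Real.pi)) :
    ∫ t in (0 : ℝ)..Real.pi, (g t + g (-t)) = ∫ t in (0 : ℝ)..(2 * Real.pi), g t := by
  have hi : ∀ a b : ℝ, IntervalIntegrable g volume a b := fun a b => hg.intervalIntegrable a b
  have h := hp.intervalIntegral_add_eq (-Real.pi) 0
  rw [zero_add, show -Real.pi + 2 * Real.pi = Real.pi by ring] at h
  have hi' : IntervalIntegrable (fun t => g (-t)) volume 0 Real.pi :=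
    (hg.comp continuous_neg).intervalIntegrable _ _
  rw [intervalIntegral.integral_add (hi _ _) hi', intervalIntegral.integral_comp_neg, ← h,
    neg_zero, add_comm, intervalIntegral.integral_add_adjacent_intervals (hi _ _) (hi _ _)]

lemma circleIntegral_eq_zero_of_assocQuot (n m l : ℕ) :
    (∮ z in C(0, 1), (z ^ 2 + 1) ^ m * (z ^ 2 - 1) * z ^ l * assocQuot n (z ^ 2)) = 0 := by
  have hmap : MapsTo (fun z : ℂ => z ^ 2) (Metric.closedBall 0 1) (Metric.closedBall 0 1) := by
    intro z hz
    simp only [mem_closedBall_zero_iff, norm_pow] at hz ⊢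
    exact pow_le_one₀ (norm_nonneg _) hz
  have hmap' : MapsTo (fun z : ℂ => z ^ 2) (Metric.ball 0 1) (Metric.ball 0 1) := by
    intro z hz
    simp only [mem_ball_zero_iff, norm_pow] at hz ⊢
    exact pow_lt_one₀ (norm_nonneg _) hz two_ne_zero
  have hd : DiffContOnCl ℂ (fun z : ℂ => assocQuot n (z ^ 2)) (Metric.ball 0 1) := by
    refine ⟨(differentiableOn_assocQuot n).comp (by fun_prop) hmap', ?_⟩
    rw [closure_ball _ one_ne_zero]
    exact (continuousOn_assocQuot n).comp (by fun_prop) hmap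
  have hp : Differentiable ℂ fun z : ℂ => (z ^ 2 + 1) ^ m * (z ^ 2 - 1) * z ^ l := by fun_prop
  exact (hp.diffContOnCl.smul hd).circleIntegral_eq_zero zero_le_one

/-- Conjugation symmetry unfolds the imaginary part into an integral over the full circle. There
`cos^m t · sin t` has denominator `z^(m+1)` and `dt` one more `z`, so the power left is `z^(n-m-1) =
z^l`, with no pole exactly when `m < n`. -/
lemma integral_cos_pow_mul_sin_mul_im (n m l : ℕ) (hn : n = m + 1 + l) :
    ∫ t in (0 : ℝ)..Real.pi, ((Real.cos t : ℂ) ^ m * Real.sin t *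
      ((Complex.exp (t * Complex.I) ^ (n + 1) *
        assocQuot n (Complex.exp (t * Complex.I) ^ 2)).im : ℝ)) = 0 := by
  have hc : Continuous fun t : ℝ => assocQuot n (Complex.exp (t * Complex.I) ^ 2) :=
    (continuousOn_assocQuot n).comp_continuous (by fun_prop) fun t => by
      simp [Complex.norm_exp_ofReal_mul_I]
  set g : ℝ → ℂ := fun t => (Real.cos t : ℂ) ^ m * Real.sin t *
      (Complex.exp (t * Complex.I) ^ (n + 1) *
        assocQuot n (Complex.exp (t * Complex.I) ^ 2)) with hg
  have hgc : Continuous g := by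
    have h1 : Continuous fun t : ℝ => (Real.cos t : ℂ) ^ m * Real.sin t *
      Complex.exp (t * Complex.I) ^ (n + 1) := by fun_prop
    exact (h1.mul hc).congr fun t => mul_assoc _ _ _
  have hper : Function.Periodic g (2 * Real.pi) := by
    intro t
    have : Complex.exp (((t + 2 * Real.pi : ℝ) : ℂ) * Complex.I) = Complex.exp (t * Complex.I) := by
      rw [← Complex.exp_periodic (t * Complex.I)]
      congr 1
      push_cast
      ring
    simp only [hg, this, Real.cos_add_two_pi, Real.sin_add_two_pi]
  have h0 : ∫ t in (0 : ℝ)..(2 * Real.pi), g t = 0 := by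
    have h := circleIntegral_eq_zero_of_assocQuot n m l
    rw [circleIntegral] at h
    have e : ∀ t : ℝ, g t = (-1 / (2 * 2 ^ m) : ℂ) • (deriv (circleMap 0 1) t •
        ((circleMap 0 1 t ^ 2 + 1) ^ m * (circleMap 0 1 t ^ 2 - 1) * circleMap 0 1 t ^ l *
          assocQuot n (circleMap 0 1 t ^ 2))) := by
      intro t
      have hz : circleMap 0 1 t = Complex.exp (t * Complex.I) := by simp [circleMap]
      have hz0 := Complex.exp_ne_zero (t * Complex.I)
      have hcos : (Real.cos t : ℂ) * (2 * Complex.exp (t * Complex.I)) =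
          Complex.exp (t * Complex.I) ^ 2 + 1 := by
        rw [Complex.ofReal_cos, Complex.cos, neg_mul, Complex.exp_neg]
        field_simp
      have hsin : (Real.sin t : ℂ) * (2 * Complex.exp (t * Complex.I)) =
          -Complex.I * (Complex.exp (t * Complex.I) ^ 2 - 1) := by
        rw [Complex.ofReal_sin, Complex.sin, neg_mul, Complex.exp_neg]
        field_simp
        ring
      rw [deriv_circleMap, hz, ← hcos]
      have hsin' : Complex.exp (t * Complex.I) ^ 2 - 1 =
          Complex.I * ((Real.sin t : ℂ) * (2 * Complex.exp (t * Complex.I))) := by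
        rw [hsin]
        linear_combination (Complex.exp (t * Complex.I) ^ 2 - 1) * Complex.I_sq
      rw [hsin']
      simp only [hg, smul_eq_mul, hn]
      field_simp
      rw [Complex.I_sq]
      ring
    simp_rw [e]
    rw [intervalIntegral.integral_smul, h, smul_zero]
  have e : ∀ t : ℝ, (Real.cos t : ℂ) ^ m * Real.sin t * ((Complex.exp (t * Complex.I) ^ (n + 1) *
        assocQuot n (Complex.exp (t * Complex.I) ^ 2)).im : ℝ) =
      (1 / (2 * Complex.I)) • (g t + g (-t)) := by
    intro t
    have hconj : Complex.exp (((-t : ℝ) : ℂ) * Complex.I) =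
        starRingEnd ℂ (Complex.exp (t * Complex.I)) := by
      rw [← Complex.exp_conj]
      simp
    have hI := Complex.I_ne_zero
    rw [Complex.im_eq_sub_conj]
    simp only [hg, hconj, Real.cos_neg, Real.sin_neg, map_mul, map_pow, ← assocQuot_conj]
    push_cast
    rw [smul_eq_mul]
    ring
  simp_rw [e]
  rw [intervalIntegral.integral_smul, integral_add_comp_neg_of_periodic hgc hper, h0, smul_zero]

lemma integral_pow_mul_q_mul_weightExtension {m n : ℕ} (hmn : m < n) :
    ∫ x in (-1 : ℝ)..1, (x : ℂ) ^ m * ((q n).eval (x : ℂ) * (weightExtension x : ℂ)) = 0 := by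
  obtain ⟨l, hl⟩ := Nat.exists_eq_add_of_le (Nat.succ_le_of_lt hmn)
  obtain ⟨K, hK⟩ := exists_eval_q_mul_weight n
  have hc : Continuous fun x : ℝ =>
      (x : ℂ) ^ m * ((q n).eval (x : ℂ) * (weightExtension x : ℂ)) := by
    have h1 := continuous_weightExtension
    have h2 : Continuous fun x : ℝ => (q n).eval (x : ℂ) :=
      (q n).continuous.comp Complex.continuous_ofReal
    fun_prop
  -- Substitution `x = cos t`, which reverses the orientation; `weightExtension` keeps the integrand
  -- continuous up to the endpoints.
  have h := intervalIntegral.integral_deriv_smul_comp (a := 0) (b := Real.pi)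
    (f := Real.cos) (f' := fun t => -Real.sin t) (fun t _ => Real.hasDerivAt_cos t)
    (by fun_prop) hc
  rw [Real.cos_zero, Real.cos_pi] at h
  rw [intervalIntegral.integral_symm 1 (-1), neg_eq_zero, ← h]
  have e : ∀ t ∈ Ioo 0 Real.pi, (-Real.sin t) • ((fun x : ℝ => (x : ℂ) ^ m *
      ((q n).eval (x : ℂ) * (weightExtension x : ℂ))) ∘ Real.cos) t =
      (-K) • ((Real.cos t : ℂ) ^ m * Real.sin t *
        ((Complex.exp (t * Complex.I) ^ (n + 1) *
          assocQuot n (Complex.exp (t * Complex.I) ^ 2)).im : ℝ)) := by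
    intro t ht
    simp only [Function.comp_apply, hK t ht, smul_eq_mul, Complex.real_smul]
    push_cast
    ring
  rw [intervalIntegral.integral_congr_Ioo_of_le Real.pi_pos.le e, intervalIntegral.integral_smul,
    integral_cos_pow_mul_sin_mul_im n m l (by omega), smul_zero]

lemma integral_eval_mul_q_mul_weightExtension {p : ℂ[X]} {n : ℕ} (hp : p.degree < n) :
    ∫ x in (-1 : ℝ)..1, p.eval (x : ℂ) * ((q n).eval (x : ℂ) * (weightExtension x : ℂ)) = 0 := by
  have e : ∀ x : ℝ, p.eval (x : ℂ) * ((q n).eval (x : ℂ) * (weightExtension x : ℂ)) =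
      ∑ m ∈ p.support, p.coeff m •
        ((x : ℂ) ^ m * ((q n).eval (x : ℂ) * (weightExtension x : ℂ))) := by
    intro x
    rw [eval_eq_sum, Polynomial.sum, Finset.sum_mul]
    exact Finset.sum_congr rfl fun m _ => by rw [smul_eq_mul, mul_assoc]
  simp_rw [e]
  rw [intervalIntegral.integral_finsetSum]
  · refine Finset.sum_eq_zero fun m hm => ?_
    rw [intervalIntegral.integral_smul, integral_pow_mul_q_mul_weightExtension, smul_zero]
    exact_mod_cast (le_degree_of_ne_zero (mem_support_iff.1 hm)).trans_lt hp
  · intro m _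
    have h1 := continuous_weightExtension
    have h2 : Continuous fun x : ℝ => (q n).eval (x : ℂ) :=
      (q n).continuous.comp Complex.continuous_ofReal
    exact Continuous.intervalIntegrable (by fun_prop) _ _

lemma wInner_ultrasphericalWeight_q (m n : ℕ) :
    wInner (ultrasphericalWeight (-1 / 2) (3 / 2)) (toFun (q m)) (toFun (q n)) =
      ∫ x in (-1 : ℝ)..1,
        (q m).eval (x : ℂ) * ((q n).eval (x : ℂ) * (weightExtension x : ℂ)) := by
  have e : ∀ x : ℝ, toFun (q m) x * starRingEnd ℂ (toFun (q n) x) *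
      (((Ioo (-1 : ℝ) 1).indicator weightExtension x : ℝ) : ℂ) =
      (Ioo (-1 : ℝ) 1).indicator (fun x : ℝ =>
        (q m).eval (x : ℂ) * ((q n).eval (x : ℂ) * (weightExtension x : ℂ))) x := by
    intro x
    by_cases hx : x ∈ Ioo (-1 : ℝ) 1
    · simp only [toFun, conj_eval_q, indicator_of_mem hx, mul_assoc]
    · simp only [indicator_of_notMem hx, Complex.ofReal_zero, mul_zero]
  rw [wInner, ultrasphericalWeight_eq_indicator]
  simp_rw [e]
  rw [integral_indicator measurableSet_Ioo, intervalIntegral.integral_of_le (by norm_num),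
    integral_Ioc_eq_integral_Ioo]

lemma isOrthogonal_q : IsOrthogonal (ultrasphericalWeight (-1 / 2) (3 / 2)) q := by
  refine ⟨degree_q, fun m n hmn => ?_⟩
  rw [wInner_ultrasphericalWeight_q]
  rcases hmn.lt_or_gt with h | h
  · exact integral_eval_mul_q_mul_weightExtension (by rw [degree_q]; exact_mod_cast h)
  -- The integrand is symmetric in `m` and `n`, so the factor of larger degree can always play the
  -- role of `q n`.
  · simp_rw [mul_left_comm ((q m).eval _)]
    exact integral_eval_mul_q_mul_weightExtension (by rw [degree_q]; exact_mod_cast h)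

end DJKM

theorem mainTheorem4 :
    (∀ n : ℕ, DJKM.P (2 * n + 1) = 0) ∧
    (∀ n : ℕ, DJKM.q n = DJKM.assocUltraspherical (-1 / 2) (3 / 2) n) ∧
    DJKM.IsWeight (DJKM.ultrasphericalWeight (-1 / 2) (3 / 2)) ∧
    DJKM.IsOrthogonal (DJKM.ultrasphericalWeight (-1 / 2) (3 / 2)) DJKM.q ∧
    (∀ w : ℝ → ℝ, DJKM.IsWeight w → DJKM.IsOrthogonal w DJKM.q →
      ¬ DJKM.IsClassical w DJKM.q) := by
  refine ⟨DJKM.P_odd, DJKM.q_eq_assocUltraspherical, DJKM.isWeight_ultrasphericalWeight,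
    DJKM.isOrthogonal_q, ?_⟩
  rintro w - - ⟨f, hf, -, γ, h⟩
  exact hf (DJKM.eq_zero_of_forall_diffOp_q h)
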